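/- Let $X$ be a non-empty compact metric space and $\mathcal P(X)$ the set of Borel probability measures on $X$ with the weak$^*$ topology. Let $\mathcal T:\mathcal P(X)\times\mathcal P(X)\to\mathbb R$ be jointly convex and weak$^*$ continuous, and assume that $\mathcal T$ is a backward linear transfer: there is a map $T:C(X)\to LSC(X)$ (its backward Kantorovich operator) such that $$\sup_{\nu\in\mathcal P(X)}\Big\{\int_X g\,d\nu-\mathcal T(\mu,\nu)\Big\}=\int_X Tg\,d\mu\qquad\text{for all }\mu\in\mathcal P(X),\ g\in C(X);$$ $T$ is then unique, $Tg(x)=\sup_{\nu}\{\int g\,d\nu-\mathcal T(\delta_x,\nu)\}$, and maps $C(X)$ into $C(X)$. Let $\mathcal T_1=\mathcal T$ and $\mathcal T_{n+1}(\mu,\nu)=\inf_{\sigma\in\mathcal P(X)}\{\mathcal T_n(\mu,\sigma)+\mathcal T(\sigma,\nu)\}$, and let $\ell\in\mathbb R$ be the number such that $\mathcal T_n(\mu,\nu)/n\to\ell$ for all $\mu,\nu$ (equivalently, such that $|\mathcal T_n(\mu,\nu)-\ell n|\le C$ for all $n\ge 1$, $\mu$, $\nu$ and some constant $C$). Assume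 $\ell=0$. For $f\in C(X)$ put $$T^1_\infty f(x)=\limsup_{n\to\infty}T^nf(x),\qquad T_\infty f(x)=\lim_{n\to\infty}T^n\big(T^1_\infty f\big)(x),$$ where $T^n$ is the $n$-th iterate of $T$, and $$\mathcal T_\infty(\mu,\nu)=\sup\Big\{\int_X f\,d\nu-\int_X T_\infty f\,d\mu\;:\;f\in C(X)\Big\}.$$ Let $\mathcal A=\{\mu\in\mathcal P(X):\mathcal T_\infty(\mu,\mu)=0\}$ (the projected Aubry set) and $\mathcal D=\{(\mu,\nu)\in\mathcal P(X)\times\mathcal P(X):\mathcal T(\mu,\nu)+\mathcal T_\infty(\nu,\mu)=0\}$ (the generalized Aubry set). Then $$\inf\{\mathcal T(\mu,\mu):\mu\in\mathcal P(X)\}=0,$$ and the infimum is attained at some $\bar\mu\in\mathcal A$ such that $(\bar\mu,\bar\mu)\in\mathcal D$. -/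

import Mathlib

open MeasureTheory Filter Topology
open scoped NNReal

noncomputable section

namespace Transfer

/-- Joint convexity of a functional of two probability measures: whenever
`μ = s μ₁ + t μ₂` and `ν = s ν₁ + t ν₂` with `s, t ≥ 0`, `s + t = 1`, one has
`T(μ, ν) ≤ s T(μ₁, ν₁) + t T(μ₂, ν₂)`. -/
def JointlyConvex {X Y : Type*} [MeasurableSpace X] [MeasurableSpace Y]
    (T : ProbabilityMeasure X → ProbabilityMeasure Y → ℝ) : Prop :=
  ∀ (μ₁ μ₂ μ : ProbabilityMeasure X) (ν₁ ν₂ ν : ProbabilityMeasure Y) (s t : ℝ≥0),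
    s + t = 1 →
    (μ : Measure X) = s • (μ₁ : Measure X) + t • (μ₂ : Measure X) →
    (ν : Measure Y) = s • (ν₁ : Measure Y) + t • (ν₂ : Measure Y) →
    T μ ν ≤ s * T μ₁ ν₁ + t * T μ₂ ν₂

/-- The Legendre transform of the partial map `T_μ = T(μ, ·)`:
`T_μ^*(g) = sup { ∫ g dν - T(μ, ν) : ν ∈ P(Y) }`. -/
def legendre {X Y : Type*} [MeasurableSpace X] [MeasurableSpace Y]
    (T : ProbabilityMeasure X → ProbabilityMeasure Y → ℝ)
    (μ : ProbabilityMeasure X) (g : Y → ℝ) : ℝ :=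
  ⨆ ν : ProbabilityMeasure Y, (∫ y, g y ∂(ν : Measure Y) - T μ ν)

/-- `K : C(Y) → LSC(X)` is a backward Kantorovich operator of the (everywhere finite) functional
`T`: for every `μ ∈ P(X)` and `g ∈ C(Y)`, `T_μ^*(g) = ∫ K g dμ`. -/
def IsBackwardKantorovich {X Y : Type*}
    [TopologicalSpace X] [MeasurableSpace X] [TopologicalSpace Y] [MeasurableSpace Y]
    (T : ProbabilityMeasure X → ProbabilityMeasure Y → ℝ) (K : C(Y, ℝ) → X → ℝ) : Prop :=
  ∀ g : C(Y, ℝ), LowerSemicontinuous (K g) ∧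
    ∀ μ : ProbabilityMeasure X, legendre T μ g = ∫ x, K g x ∂(μ : Measure X)

/-- An everywhere finite functional on `P(X) × P(Y)` is a backward linear transfer if it is jointly
convex, weak-* lower semicontinuous and admits a backward Kantorovich operator. The topology on
`ProbabilityMeasure` is that of weak-* convergence. -/
structure IsBackwardLinearTransfer {X Y : Type*}
    [TopologicalSpace X] [MeasurableSpace X] [OpensMeasurableSpace X]
    [TopologicalSpace Y] [MeasurableSpace Y] [OpensMeasurableSpace Y]
    (T : ProbabilityMeasure X → ProbabilityMeasure Y → ℝ) : Prop where
  convex : JointlyConvex T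
  lsc : LowerSemicontinuous fun p : ProbabilityMeasure X × ProbabilityMeasure Y => T p.1 p.2
  exists_kantorovich : ∃ K : C(Y, ℝ) → X → ℝ, IsBackwardKantorovich T K

variable {X : Type*} [MeasurableSpace X]

/-- The inf-convolution `(S ⋆ T)(μ, ν) = inf { S(μ, σ) + T(σ, ν) : σ ∈ P(X) }`. -/
def infConv (S T : ProbabilityMeasure X → ProbabilityMeasure X → ℝ)
    (μ ν : ProbabilityMeasure X) : ℝ :=
  ⨅ σ : ProbabilityMeasure X, (S μ σ + T σ ν)

/-- `convPow T n = T ⋆ T ⋆ ⋯ ⋆ T` with `n + 1` factors, i.e. `T_{n+1}`. -/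
def convPow (T : ProbabilityMeasure X → ProbabilityMeasure X → ℝ) :
    ℕ → ProbabilityMeasure X → ProbabilityMeasure X → ℝ
  | 0 => T
  | n + 1 => infConv (convPow T n) T

/-- `ℓ` is the linear growth rate of the iterated convolutions:
`T_n(μ, ν) / n → ℓ` for all `μ, ν`. -/
def HasRate (T : ProbabilityMeasure X → ProbabilityMeasure X → ℝ) (ℓ : ℝ) : Prop :=
  ∀ μ ν : ProbabilityMeasure X,
    Tendsto (fun n : ℕ => convPow T n μ ν / ((n : ℝ) + 1)) atTop (𝓝 ℓ)

/-- The backward Kantorovich operator of `T`, given by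
`(T g)(x) = sup { ∫ g dν - T(δ_x, ν) : ν ∈ P(X) }`; see `IsBackwardKantorovich.eq_kantorovich`. -/
def kantorovich (T : ProbabilityMeasure X → ProbabilityMeasure X → ℝ)
    (g : X → ℝ) : X → ℝ :=
  fun x => legendre T (diracProba x) g

/-- The Kantorovich operator of a backward linear transfer is unique on `C(X)`: it is
`kantorovich T`. -/
theorem IsBackwardKantorovich.eq_kantorovich [TopologicalSpace X] [OpensMeasurableSpace X]
    {T : ProbabilityMeasure X → ProbabilityMeasure X → ℝ} {K : C(X, ℝ) → X → ℝ}
    (h : IsBackwardKantorovich T K) (g : C(X, ℝ)) : K g = kantorovich T g := by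
  funext x
  have h1 := (h g).2 (diracProba x)
  have h2 : StronglyMeasurable (K g) := (h g).1.measurable.stronglyMeasurable
  rw [kantorovich, h1]
  exact (integral_dirac' (K g) x h2).symm

/-- `T_∞^1 f (x) = limsup_n T^n f (x)`, where `T^n` is the `n`-th iterate of the Kantorovich
operator. -/
def kantorovichLimsup (T : ProbabilityMeasure X → ProbabilityMeasure X → ℝ)
    (f : X → ℝ) : X → ℝ :=
  fun x => limsup (fun n : ℕ => (kantorovich T)^[n] f x) atTop

/-- `T_∞ f (x) = lim_n T^n (T_∞^1 f) (x)`. -/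
def kantorovichInfty (T : ProbabilityMeasure X → ProbabilityMeasure X → ℝ)
    (f : X → ℝ) : X → ℝ :=
  fun x => limUnder atTop (fun n : ℕ => (kantorovich T)^[n] (kantorovichLimsup T f) x)

/-- The generalized Peierls barrier
`T_∞(μ, ν) = sup { ∫ f dν - ∫ T_∞ f dμ : f ∈ C(X) }`, with values in the extended reals. -/
def barrier [TopologicalSpace X] (T : ProbabilityMeasure X → ProbabilityMeasure X → ℝ)
    (μ ν : ProbabilityMeasure X) : EReal :=
  ⨆ f : C(X, ℝ),
    ((∫ x, f x ∂(ν : Measure X) - ∫ x, kantorovichInfty T f x ∂(μ : Measure X) : ℝ) : EReal)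

/-- The projected Aubry set `A = { μ : T_∞(μ, μ) = 0 }`. -/
def projectedAubrySet [TopologicalSpace X]
    (T : ProbabilityMeasure X → ProbabilityMeasure X → ℝ) : Set (ProbabilityMeasure X) :=
  {μ | barrier T μ μ = 0}

/-- The generalized Aubry set `D = { (μ, ν) : T(μ, ν) + T_∞(ν, μ) = 0 }`. -/
def aubrySet [TopologicalSpace X]
    (T : ProbabilityMeasure X → ProbabilityMeasure X → ℝ) :
    Set (ProbabilityMeasure X × ProbabilityMeasure X) :=
  {p | (T p.1 p.2 : EReal) + barrier T p.2 p.1 = 0}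

end Transfer

end

/-!
The diagonal of `T` is nonnegative, since `T_n(μ, μ) ≤ n T(μ, μ)` and the rate is zero. It vanishes
somewhere: a nearly optimal chain for `T_n(μ, μ)` is a closed loop of measures, so by joint convexity
the mean `α` of its points satisfies `T(α, α) ≤ T_n(μ, μ) / n + o(1)` (`exists_mean_of_convPow_lt`), and
`P(X)` is compact (`exists_self_eq_zero`).

Any `μ` with `T(μ, μ) = 0` has zero barrier `T_∞(μ, μ)`, and hence lies in both Aubry sets. Testing the
supremum defining `T g` at `ν = μ` gives `∫ T g dμ ≥ ∫ g dμ`. The functions `T g` share a modulus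
of continuity, the oscillation of `x ↦ T(δ_x, ·) ∈ C(P(X))`, and the iterates `T^n f` are bounded
(`exists_abs_iterate_le`): below by integrating against `μ`, above because a large value of `T^N f`
would force linear growth of `T^n f` and contradict the zero rate. Hence `h = limsup T^n f` is
continuous, approached uniformly from above, and satisfies `h ≤ T h` and `∫ f dμ ≤ ∫ h dμ`. So
`T^n h` increases to a continuous fixed point, which is `T_∞ f`, and `∫ f dμ ≤ ∫ T_∞ f dμ`
(`exists_kantorovichInfty`): the barrier is at most `0`. Conversely a fixed point `g` of `T`, such as
`T_∞ 0`, satisfies `T_∞ g = g`, so the barrier is at least `0` (`barrier_self_eq_zero`).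
-/

namespace Transfer

open Set

variable {X : Type*} [MeasurableSpace X] {T : ProbabilityMeasure X → ProbabilityMeasure X → ℝ}

/-! ### Convolution powers -/

lemma neg_le_convPow [Nonempty X] {B : ℝ} (hB : ∀ μ ν, |T μ ν| ≤ B) (n : ℕ)
    (μ ν : ProbabilityMeasure X) : -((n + 1) * B) ≤ convPow T n μ ν := by
  have : Nonempty (ProbabilityMeasure X) := ⟨diracProba (Classical.arbitrary X)⟩
  induction n generalizing ν with
  | zero => simpa [convPow] using (abs_le.1 (hB μ ν)).1
  | succ n ih =>
    refine le_ciInf fun σ => ?_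
    have h1 := (abs_le.1 (hB σ ν)).1
    have h2 := ih σ
    push_cast
    linarith

lemma convPow_succ_le [Nonempty X] {B : ℝ} (hB : ∀ μ ν, |T μ ν| ≤ B) (n : ℕ)
    (μ σ ν : ProbabilityMeasure X) :
    convPow T (n + 1) μ ν ≤ convPow T n μ σ + T σ ν := by
  refine ciInf_le (f := fun σ => convPow T n μ σ + T σ ν) ⟨-((n + 1) * B) - B, ?_⟩ σ
  rintro _ ⟨σ, rfl⟩
  have h1 := (abs_le.1 (hB σ ν)).1
  have h2 := neg_le_convPow hB n μ σ
  simp only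
  linarith

lemma convPow_le_add [Nonempty X] {B : ℝ} (hB : ∀ μ ν, |T μ ν| ≤ B) (n : ℕ)
    (μ ν ν' : ProbabilityMeasure X) : convPow T n μ ν ≤ convPow T n μ ν' + 2 * B := by
  have : Nonempty (ProbabilityMeasure X) := ⟨diracProba (Classical.arbitrary X)⟩
  cases n with
  | zero =>
    have h1 := (abs_le.1 (hB μ ν)).2
    have h2 := (abs_le.1 (hB μ ν')).1
    simp only [convPow]
    linarith
  | succ n =>
    rw [← sub_le_iff_le_add]
    refine le_ciInf fun σ => ?_
    have h1 := (abs_le.1 (hB σ ν)).2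
    have h2 := (abs_le.1 (hB σ ν')).1
    have h3 := convPow_succ_le hB n μ σ ν
    linarith

lemma convPow_self_le [Nonempty X] {B : ℝ} (hB : ∀ μ ν, |T μ ν| ≤ B) (n : ℕ)
    (μ : ProbabilityMeasure X) : convPow T n μ μ ≤ (n + 1) * T μ μ := by
  induction n with
  | zero => simp [convPow]
  | succ n ih =>
    have := convPow_succ_le hB n μ μ μ
    push_cast
    linarith

lemma self_nonneg [Nonempty X] {B : ℝ} (hB : ∀ μ ν, |T μ ν| ≤ B) (hrate : HasRate T 0)
    (μ : ProbabilityMeasure X) : 0 ≤ T μ μ := by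
  refine le_of_tendsto (hrate μ μ) (Eventually.of_forall fun n => ?_)
  rw [div_le_iff₀ (by positivity), mul_comm]
  exact convPow_self_le hB n μ

/-- Averaging along a chain. If `T_{n+1}(μ, ν) < c`, then some chain
`μ = σ_0, …, σ_{n+1} = ν` has total cost `< c`; with `α` the mean of `σ_0, …, σ_n` and `β` the mean
of `σ_1, …, σ_{n+1}`, joint convexity gives `T(α, β) ≤ c / (n + 1)`, and the sum telescopes to
`(n + 1) (α - β) = μ - ν`. -/
lemma exists_mean_of_convPow_lt [Nonempty X] (hconv : JointlyConvex T) (n : ℕ)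
    (μ ν : ProbabilityMeasure X) (c : ℝ) (hc : convPow T n μ ν < c) :
    ∃ α β : ProbabilityMeasure X, (n + 1) * T α β ≤ c ∧
      ((n + 1 : ℕ) : ℝ≥0) • (α : Measure X) + (ν : Measure X) =
        ((n + 1 : ℕ) : ℝ≥0) • (β : Measure X) + (μ : Measure X) := by
  have : Nonempty (ProbabilityMeasure X) := ⟨diracProba (Classical.arbitrary X)⟩
  induction n generalizing ν c with
  | zero => exact ⟨μ, ν, by simpa [convPow] using hc.le, by simp [add_comm]⟩
  | succ n ih =>
    obtain ⟨σ, hσ⟩ := exists_lt_of_ciInf_lt hc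
    obtain ⟨α, β, hαβ, hm⟩ := ih σ (c - T σ ν) (by linarith)
    set N : ℝ≥0 := ((n + 1 : ℕ) : ℝ≥0) with hN
    have hN1 : ((n + 1 + 1 : ℕ) : ℝ≥0) = N + 1 := by rw [hN]; push_cast; ring
    have hne : N + 1 ≠ 0 := by positivity
    have hs : N / (N + 1) + 1 / (N + 1) = 1 := by rw [← add_div, div_self hne]
    have hprob : ∀ ρ τ : ProbabilityMeasure X, IsProbabilityMeasure
        ((N / (N + 1)) • (ρ : Measure X) + (1 / (N + 1)) • (τ : Measure X)) := fun ρ τ => by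
      constructor
      simp only [Measure.add_apply, Measure.smul_apply, measure_univ]
      rw [ENNReal.smul_def, ENNReal.smul_def, smul_eq_mul, smul_eq_mul, mul_one, mul_one,
        ← ENNReal.coe_add, hs, ENNReal.coe_one]
    have hscale : ∀ ρ τ : Measure X, (N + 1) • ((N / (N + 1)) • ρ + (1 / (N + 1)) • τ)
        = N • ρ + τ := fun ρ τ => by
      rw [smul_add, smul_smul, smul_smul, mul_div_cancel₀ _ hne, mul_div_cancel₀ _ hne, one_smul]
    refine ⟨⟨_, hprob α σ⟩, ⟨_, hprob β ν⟩, ?_, ?_⟩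
    · have h := hconv α σ ⟨_, hprob α σ⟩ β ν ⟨_, hprob β ν⟩ _ _ hs rfl rfl
      have hNr : (N : ℝ) = n + 1 := by rw [hN]; push_cast; ring
      rw [NNReal.coe_div, NNReal.coe_div, NNReal.coe_add, NNReal.coe_one, hNr] at h
      have hpos : (0 : ℝ) < n + 1 + 1 := by positivity
      push_cast
      calc ((n : ℝ) + 1 + 1) * T ⟨_, hprob α σ⟩ ⟨_, hprob β ν⟩
          ≤ ((n : ℝ) + 1 + 1) * ((n + 1) / (n + 1 + 1) * T α β + 1 / (n + 1 + 1) * T σ ν) :=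
            mul_le_mul_of_nonneg_left h hpos.le
        _ = (n + 1) * T α β + T σ ν := by field_simp
        _ ≤ c := by linarith
    · rw [hN1]
      simp only [ProbabilityMeasure.coe_mk]
      rw [hscale, hscale, add_assoc, add_comm (σ : Measure X), ← add_assoc,
        add_right_comm, hm, add_right_comm]

variable [MetricSpace X] [BorelSpace X]

lemma legendre_eq_integral (hT : IsBackwardLinearTransfer T) (μ : ProbabilityMeasure X)
    (g : C(X, ℝ)) : legendre T μ g = ∫ x, kantorovich T g x ∂(μ : Measure X) := by
  obtain ⟨K, hK⟩ := hT.exists_kantorovich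
  rw [(hK g).2 μ, hK.eq_kantorovich g]

variable [CompactSpace X]

/-! ### Integrals of continuous functions -/

lemma integrable_continuousMap (μ : ProbabilityMeasure X) (g : C(X, ℝ)) :
    Integrable g (μ : Measure X) :=
  g.continuous.integrable_of_hasCompactSupport (HasCompactSupport.of_compactSpace g)

lemma integral_le_integral_add (μ : ProbabilityMeasure X) (g h : C(X, ℝ)) (c : ℝ)
    (hgh : ∀ x, g x ≤ h x + c) :
    ∫ x, g x ∂(μ : Measure X) ≤ ∫ x, h x ∂(μ : Measure X) + c := by
  have hi := integral_mono (integrable_continuousMap μ g)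
    ((integrable_continuousMap μ h).add (integrable_const c)) hgh
  simp only [Pi.add_apply] at hi
  rwa [integral_add (integrable_continuousMap μ h) (integrable_const c), integral_const,
    probReal_univ, one_smul] at hi

lemma integral_le_of_forall_le (μ : ProbabilityMeasure X) (g : C(X, ℝ)) (c : ℝ)
    (hg : ∀ x, g x ≤ c) : ∫ x, g x ∂(μ : Measure X) ≤ c := by
  simpa using integral_le_integral_add μ g 0 c (by simpa using hg)

/-! ### The Legendre transform and the Kantorovich operator -/

lemma bddAbove_legendre
    (hcont : Continuous fun p : ProbabilityMeasure X × ProbabilityMeasure X => T p.1 p.2)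
    (μ : ProbabilityMeasure X) (g : C(X, ℝ)) :
    BddAbove (range fun ν : ProbabilityMeasure X => ∫ y, g y ∂(ν : Measure X) - T μ ν) := by
  have h : Continuous fun ν : ProbabilityMeasure X => ∫ y, g y ∂(ν : Measure X) - T μ ν :=
    (ProbabilityMeasure.continuous_integral_continuousMap g).sub
      (hcont.comp (by fun_prop : Continuous fun ν : ProbabilityMeasure X => (μ, ν)))
  exact (isCompact_range h).bddAbove

lemma le_legendre
    (hcont : Continuous fun p : ProbabilityMeasure X × ProbabilityMeasure X => T p.1 p.2)
    (μ ν : ProbabilityMeasure X) (g : C(X, ℝ)) :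
    ∫ y, g y ∂(ν : Measure X) - T μ ν ≤ legendre T μ g :=
  le_ciSup (bddAbove_legendre hcont μ g) ν

/-- Monotonicity of the Kantorovich operator together with its equivariance under the addition of
constants. -/
lemma kantorovich_le_add [Nonempty X]
    (hcont : Continuous fun p : ProbabilityMeasure X × ProbabilityMeasure X => T p.1 p.2)
    (g h : C(X, ℝ)) (c : ℝ) (hgh : ∀ x, g x ≤ h x + c) (x : X) :
    kantorovich T g x ≤ kantorovich T h x + c := by
  have : Nonempty (ProbabilityMeasure X) := ⟨diracProba (Classical.arbitrary X)⟩
  refine ciSup_le fun ν => ?_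
  have h1 := integral_le_integral_add ν g h c hgh
  have h2 := le_legendre hcont (diracProba x) ν h
  simp only [kantorovich]
  linarith

/-- The map `x ↦ T(δ_x, ·)` from `X` to `C(P(X))`. Since `P(X)` is compact, the pseudo-distance it
induces on `X` is continuous; it is a common modulus of continuity of all the functions `T g`. -/
noncomputable def diracSlice
    (hcont : Continuous fun p : ProbabilityMeasure X × ProbabilityMeasure X => T p.1 p.2) :
    C(X, C(ProbabilityMeasure X, ℝ)) :=
  ContinuousMap.curry ⟨fun p : X × ProbabilityMeasure X => T (diracProba p.1) p.2,
    hcont.comp ((continuous_diracProba.comp continuous_fst).prodMk continuous_snd)⟩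

lemma kantorovich_le_add_dist [Nonempty X]
    (hcont : Continuous fun p : ProbabilityMeasure X × ProbabilityMeasure X => T p.1 p.2)
    (g : C(X, ℝ)) (x y : X) :
    kantorovich T g x ≤ kantorovich T g y + dist (diracSlice hcont x) (diracSlice hcont y) := by
  have : Nonempty (ProbabilityMeasure X) := ⟨diracProba (Classical.arbitrary X)⟩
  refine ciSup_le fun ν => ?_
  have h1 : dist (T (diracProba x) ν) (T (diracProba y) ν) ≤ _ :=
    ContinuousMap.dist_apply_le_dist (f := diracSlice hcont x) (g := diracSlice hcont y) ν
  rw [Real.dist_eq] at h1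
  have h2 := le_legendre hcont (diracProba y) ν g
  have h3 := (abs_le.1 h1).1
  simp only [kantorovich]
  linarith

/-- A function with modulus of continuity `dist (T(δ_x, ·)) (T(δ_y, ·))` is continuous. -/
lemma continuous_of_le_add_dist
    (hcont : Continuous fun p : ProbabilityMeasure X × ProbabilityMeasure X => T p.1 p.2)
    {u : X → ℝ} (hu : ∀ x y, u x ≤ u y + dist (diracSlice hcont x) (diracSlice hcont y)) :
    Continuous u := by
  refine continuous_iff_continuousAt.2 fun x => ?_
  have h : Tendsto (fun y => dist (diracSlice hcont y) (diracSlice hcont x)) (𝓝 x) (𝓝 0) :=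
    tendsto_iff_dist_tendsto_zero.1 (diracSlice hcont).continuous.continuousAt
  refine tendsto_iff_dist_tendsto_zero.2 (squeeze_zero (fun _ => dist_nonneg) (fun y => ?_) h)
  have h1 := hu x y
  have h2 := hu y x
  rw [dist_comm (diracSlice hcont x)] at h1
  rw [Real.dist_eq, abs_le]
  constructor <;> linarith

/-- The Kantorovich operator as a self-map of `C(X)`. -/
noncomputable def kantorovichMap [Nonempty X]
    (hcont : Continuous fun p : ProbabilityMeasure X × ProbabilityMeasure X => T p.1 p.2)
    (g : C(X, ℝ)) : C(X, ℝ) :=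
  ⟨kantorovich T g, continuous_of_le_add_dist hcont (kantorovich_le_add_dist hcont g)⟩

lemma coe_kantorovichMap_iterate [Nonempty X]
    (hcont : Continuous fun p : ProbabilityMeasure X × ProbabilityMeasure X => T p.1 p.2)
    (g : C(X, ℝ)) (n : ℕ) :
    ((kantorovichMap hcont)^[n] g : X → ℝ) = (kantorovich T)^[n] g := by
  have h : Function.Semiconj (fun g : C(X, ℝ) => (g : X → ℝ)) (kantorovichMap hcont)
      (kantorovich T) := fun _ => rfl
  exact h.iterate_right n g

lemma kantorovichMap_iterate_le_add [Nonempty X]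
    (hcont : Continuous fun p : ProbabilityMeasure X × ProbabilityMeasure X => T p.1 p.2)
    (g h : C(X, ℝ)) (c : ℝ) (hgh : ∀ x, g x ≤ h x + c) (n : ℕ) (x : X) :
    (kantorovichMap hcont)^[n] g x ≤ (kantorovichMap hcont)^[n] h x + c := by
  induction n generalizing x with
  | zero => exact hgh x
  | succ n ih =>
    simp only [Function.iterate_succ_apply']
    exact kantorovich_le_add hcont _ _ c ih x

lemma kantorovichMap_iterate_le_add_dist [Nonempty X]
    (hcont : Continuous fun p : ProbabilityMeasure X × ProbabilityMeasure X => T p.1 p.2)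
    (g : C(X, ℝ)) (n : ℕ) (x y : X) :
    (kantorovichMap hcont)^[n + 1] g x ≤
      (kantorovichMap hcont)^[n + 1] g y + dist (diracSlice hcont x) (diracSlice hcont y) := by
  simp only [Function.iterate_succ_apply']
  exact kantorovich_le_add_dist hcont _ x y

/-! ### The diagonal of `T` -/

lemma exists_abs_le
    (hcont : Continuous fun p : ProbabilityMeasure X × ProbabilityMeasure X => T p.1 p.2) :
    ∃ B : ℝ, ∀ μ ν, |T μ ν| ≤ B := by
  obtain ⟨B, hB⟩ := (isCompact_range hcont.abs).bddAbove
  exact ⟨B, fun μ ν => hB ⟨(μ, ν), rfl⟩⟩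

/-- For `ν = μ` the two means of `exists_mean_of_convPow_lt` coincide, so the diagonal of `T` gets
below `T_{n+1}(μ, μ) / (n + 1) → 0`. -/
lemma exists_self_eq_zero [Nonempty X] (hconv : JointlyConvex T)
    (hcont : Continuous fun p : ProbabilityMeasure X × ProbabilityMeasure X => T p.1 p.2)
    (hrate : HasRate T 0) : ∃ μ : ProbabilityMeasure X, T μ μ = 0 := by
  have : Nonempty (ProbabilityMeasure X) := ⟨diracProba (Classical.arbitrary X)⟩
  obtain ⟨B, hB⟩ := exists_abs_le hcont
  have hd : Continuous fun μ : ProbabilityMeasure X => T μ μ :=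
    hcont.comp (continuous_id.prodMk continuous_id)
  obtain ⟨μ, -, hμ⟩ := isCompact_univ.exists_isMinOn univ_nonempty hd.continuousOn
  refine ⟨μ, le_antisymm ?_ (self_nonneg hB hrate μ)⟩
  refine ge_of_tendsto (hrate μ μ) (Eventually.of_forall fun n => ?_)
  rw [le_div_iff₀ (by positivity), mul_comm]
  refine le_of_forall_gt_imp_ge_of_dense fun c hc => ?_
  obtain ⟨α, β, hαβ, hm⟩ := exists_mean_of_convPow_lt hconv n μ μ c hc
  have hab : α = β := by
    refine Subtype.ext (Measure.ext fun s _ => ?_)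
    have h := congrArg (fun m : Measure X => m s) hm
    simp only [Measure.add_apply, Measure.smul_apply] at h
    have h' := (ENNReal.add_left_inj (measure_ne_top (μ : Measure X) s)).1 h
    rw [ENNReal.smul_def, ENNReal.smul_def, smul_eq_mul, smul_eq_mul] at h'
    exact (ENNReal.mul_right_inj (by simp) ENNReal.coe_ne_top).1 h'
  subst hab
  refine le_trans ?_ hαβ
  have : T μ μ ≤ T α α := hμ (mem_univ α)
  gcongr

/-! ### Uniform bounds on the iterates -/

/-- One half of the duality `∫ T^n f dμ = sup_ν {∫ f dν - T_n(μ, ν)}`; the indices are shifted by one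
because `convPow T n` is `T_{n+1}`. -/
lemma integral_iterate_le [Nonempty X] (hT : IsBackwardLinearTransfer T)
    (hcont : Continuous fun p : ProbabilityMeasure X × ProbabilityMeasure X => T p.1 p.2)
    (n : ℕ) (f : C(X, ℝ)) (μ : ProbabilityMeasure X) (c : ℝ)
    (hc : ∀ ν : ProbabilityMeasure X, ∫ x, f x ∂(ν : Measure X) - convPow T n μ ν ≤ c) :
    ∫ x, (kantorovichMap hcont)^[n + 1] f x ∂(μ : Measure X) ≤ c := by
  have : Nonempty (ProbabilityMeasure X) := ⟨diracProba (Classical.arbitrary X)⟩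
  obtain ⟨B, hB⟩ := exists_abs_le hcont
  induction n generalizing f with
  | zero =>
    have h := legendre_eq_integral hT μ f
    exact h.symm.trans_le (ciSup_le hc)
  | succ n ih =>
    rw [Function.iterate_succ_apply]
    refine ih _ fun σ => ?_
    have h := legendre_eq_integral hT σ f
    have h' : legendre T σ f ≤ c + convPow T n μ σ := ciSup_le fun ν => by
      have h1 := hc ν
      have h2 := convPow_succ_le hB n μ σ ν
      linarith
    rw [h] at h'
    exact sub_le_iff_le_add.2 h'

lemma integral_le_integral_iterate [Nonempty X] (hT : IsBackwardLinearTransfer T)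
    (hcont : Continuous fun p : ProbabilityMeasure X × ProbabilityMeasure X => T p.1 p.2)
    {μ : ProbabilityMeasure X} (hμ : T μ μ = 0) (f : C(X, ℝ)) (n : ℕ) :
    ∫ x, f x ∂(μ : Measure X) ≤ ∫ x, (kantorovichMap hcont)^[n] f x ∂(μ : Measure X) := by
  induction n with
  | zero => rfl
  | succ n ih =>
    rw [Function.iterate_succ_apply']
    refine ih.trans ?_
    have h := le_legendre hcont μ μ ((kantorovichMap hcont)^[n] f)
    rw [hμ, sub_zero, legendre_eq_integral hT] at h
    exact h

lemma dist_diracSlice_le [Nonempty X]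
    (hcont : Continuous fun p : ProbabilityMeasure X × ProbabilityMeasure X => T p.1 p.2)
    {B : ℝ} (hB : ∀ μ ν, |T μ ν| ≤ B) (x y : X) :
    dist (diracSlice hcont x) (diracSlice hcont y) ≤ 2 * B := by
  have : Nonempty (ProbabilityMeasure X) := ⟨diracProba (Classical.arbitrary X)⟩
  refine ContinuousMap.dist_le_iff_of_nonempty.2 fun ν => ?_
  have h1 := abs_le.1 (hB (diracProba x) ν)
  have h2 := abs_le.1 (hB (diracProba y) ν)
  change dist (T (diracProba x) ν) (T (diracProba y) ν) ≤ _
  rw [Real.dist_eq, abs_le]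
  constructor <;> linarith

/-- If `T^N f` ever exceeded `‖f‖ + 2B + 1`, then `T^N f ≥ f + 1` and hence `T^{kN} f ≥ f + k`:
linear growth, which the rate `0` excludes. -/
lemma iterate_le [Nonempty X] (hT : IsBackwardLinearTransfer T)
    (hcont : Continuous fun p : ProbabilityMeasure X × ProbabilityMeasure X => T p.1 p.2)
    (hrate : HasRate T 0) {B : ℝ} (hB : ∀ μ ν, |T μ ν| ≤ B) (f : C(X, ℝ)) (n : ℕ) (x : X) :
    (kantorovichMap hcont)^[n + 1] f x ≤ ‖f‖ + 2 * B + 1 := by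
  by_contra! hx
  set N := n + 1 with hN
  have hf : ∀ y, |f y| ≤ ‖f‖ := fun y => f.norm_coe_le_norm y
  have hstep : ∀ y, f y ≤ (kantorovichMap hcont)^[N] f y + -1 := fun y => by
    have h1 := kantorovichMap_iterate_le_add_dist hcont f n x y
    have h2 := dist_diracSlice_le hcont hB x y
    have h3 := (abs_le.1 (hf y)).2
    linarith
  have hgrow : ∀ k : ℕ, ∀ y, f y + k ≤ (kantorovichMap hcont)^[k * N] f y := fun k => by
    induction k with
    | zero => simp
    | succ k ih =>
      intro y
      have h := kantorovichMap_iterate_le_add hcont _ _ _ hstep (k * N) y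
      rw [← Function.iterate_add_apply] at h
      have := ih y
      rw [Nat.succ_mul]
      push_cast
      linarith
  set δ := diracProba x
  have hupper : ∀ k : ℕ, convPow T ((k + 1) * N - 1) δ δ / (((((k + 1) * N - 1 : ℕ)) : ℝ) + 1)
      ≤ (2 * ‖f‖ + 2 * B) / (((((k + 1) * N - 1 : ℕ)) : ℝ) + 1) - 1 / N := fun k => by
    have hpos : 1 ≤ (k + 1) * N := Nat.mul_pos k.succ_pos n.succ_pos
    have hcast : ((((k + 1) * N - 1 : ℕ)) : ℝ) + 1 = (k + 1) * N := by
      rw [Nat.cast_sub hpos]; push_cast; ring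
    have h1 := integral_iterate_le hT hcont ((k + 1) * N - 1) f δ
      (‖f‖ + (2 * B - convPow T ((k + 1) * N - 1) δ δ)) fun ν => by
        have h2 := convPow_le_add hB ((k + 1) * N - 1) δ δ ν
        have h3 := integral_le_of_forall_le ν f ‖f‖ fun y => (abs_le.1 (hf y)).2
        linarith
    rw [Nat.sub_add_cancel hpos] at h1
    have h4 : ∫ y, (kantorovichMap hcont)^[(k + 1) * N] f y ∂(δ : Measure X)
        = (kantorovichMap hcont)^[(k + 1) * N] f x :=
      integral_dirac' _ x (ContinuousMap.continuous _).stronglyMeasurable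
    have h5 := hgrow (k + 1) x
    have h6 := (abs_le.1 (hf x)).1
    rw [h4] at h1
    have hNpos : (0 : ℝ) < N := by positivity
    have hkpos : (0 : ℝ) < k + 1 := by positivity
    rw [hcast, div_le_iff₀ (by positivity)]
    have : ((2 * ‖f‖ + 2 * B) / ((k + 1) * N) - 1 / N) * ((k + 1) * N)
        = 2 * ‖f‖ + 2 * B - (k + 1) := by field_simp
    rw [this]
    push_cast at h5
    linarith
  have hsub : Tendsto (fun k : ℕ => (k + 1) * N - 1) atTop atTop := by
    refine tendsto_atTop_mono (fun k => ?_) tendsto_id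
    have : (k + 1) * 1 ≤ (k + 1) * N := Nat.mul_le_mul_left _ n.succ_pos
    simp only [id]
    omega
  have hinf : Tendsto (fun k : ℕ => ((((k + 1) * N - 1 : ℕ)) : ℝ) + 1) atTop atTop :=
    tendsto_atTop_add_const_right _ _ (tendsto_natCast_atTop_atTop.comp hsub)
  have hlim := le_of_tendsto_of_tendsto' ((hrate δ δ).comp hsub)
    ((hinf.const_div_atTop (2 * ‖f‖ + 2 * B)).sub_const (1 / (N : ℝ))) hupper
  have : (0 : ℝ) < 1 / N := by positivity
  linarith

/-- When `T(μ, μ) = 0` the integrals `∫ T^n f dμ` stay above `∫ f dμ ≥ -‖f‖`, and `T^{n+1} f`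
oscillates by at most `2B`. -/
lemma le_iterate [Nonempty X] (hT : IsBackwardLinearTransfer T)
    (hcont : Continuous fun p : ProbabilityMeasure X × ProbabilityMeasure X => T p.1 p.2)
    {μ : ProbabilityMeasure X} (hμ : T μ μ = 0) {B : ℝ} (hB : ∀ μ ν, |T μ ν| ≤ B)
    (f : C(X, ℝ)) (n : ℕ) (x : X) :
    -(‖f‖ + 2 * B) ≤ (kantorovichMap hcont)^[n + 1] f x := by
  have h1 := integral_le_integral_iterate hT hcont hμ f (n + 1)
  have h2 := integral_le_of_forall_le μ ((kantorovichMap hcont)^[n + 1] f)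
    ((kantorovichMap hcont)^[n + 1] f x + 2 * B) fun y => by
      have h1 := kantorovichMap_iterate_le_add_dist hcont f n y x
      have h2 := dist_diracSlice_le hcont hB y x
      linarith
  have h3 := integral_le_of_forall_le μ (-f) ‖f‖ fun y =>
    (neg_le_abs (f y)).trans (f.norm_coe_le_norm y)
  simp only [ContinuousMap.neg_apply, integral_neg] at h3
  linarith

lemma exists_abs_iterate_le [Nonempty X] (hT : IsBackwardLinearTransfer T)
    (hcont : Continuous fun p : ProbabilityMeasure X × ProbabilityMeasure X => T p.1 p.2)
    (hrate : HasRate T 0) (f : C(X, ℝ)) :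
    ∃ C : ℝ, ∀ n x, |(kantorovichMap hcont)^[n] f x| ≤ C := by
  obtain ⟨B, hB⟩ := exists_abs_le hcont
  obtain ⟨μ, hμ⟩ := exists_self_eq_zero hT.convex hcont hrate
  have hB0 : 0 ≤ B := (abs_nonneg _).trans (hB μ μ)
  refine ⟨‖f‖ + 2 * B + 1, fun n x => ?_⟩
  cases n with
  | zero => exact (f.norm_coe_le_norm x).trans (by linarith)
  | succ n =>
    have := le_iterate hT hcont hμ hB f n x
    exact abs_le.2 ⟨by linarith, iterate_le hT hcont hrate hB f n x⟩

/-! ### The upper limit of the iterates and the fixed point above it -/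

/-- The upper limit of a bounded sequence with a common modulus of continuity is continuous, and by
compactness the bound `u n ≤ limsup u + ε` holds uniformly for large `n`. The modulus is asked for
from index `1` on because `T^0 f = f` need not have it. -/
lemma eventually_forall_le_limsup_add
    (hcont : Continuous fun p : ProbabilityMeasure X × ProbabilityMeasure X => T p.1 p.2)
    {u : ℕ → X → ℝ} {C : ℝ} (hC : ∀ n x, |u n x| ≤ C)
    (hu : ∀ n x y, u (n + 1) x ≤
      u (n + 1) y + dist (diracSlice hcont x) (diracSlice hcont y))
    {h : X → ℝ} (hh : ∀ x, h x = limsup (fun n => u n x) atTop) {ε : ℝ} (hε : 0 < ε) :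
    Continuous h ∧ ∀ᶠ n in atTop, ∀ x, u n x ≤ h x + ε := by
  have hbdd : ∀ x, IsBoundedUnder (· ≤ ·) atTop fun n => u n x := fun x =>
    isBoundedUnder_of ⟨C, fun n => (abs_le.1 (hC n x)).2⟩
  have hcobdd : ∀ x, IsCoboundedUnder (· ≤ ·) atTop fun n => u n x := fun x =>
    (isBoundedUnder_of ⟨-C, fun n => (abs_le.1 (hC n x)).1⟩ :
      IsBoundedUnder (· ≥ ·) atTop fun n => u n x).isCoboundedUnder_le
  have hnear : ∀ (x : X) (δ : ℝ), 0 < δ → ∀ᶠ n in atTop, u n x < h x + δ := fun x δ hδ =>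
    eventually_lt_of_limsup_lt (by rw [← hh x]; linarith) (hbdd x)
  have hmod : ∀ x y, h x ≤ h y + dist (diracSlice hcont x) (diracSlice hcont y) := fun x y => by
    refine le_of_forall_pos_le_add fun δ hδ => ?_
    rw [hh x]
    refine limsup_le_of_le (hcobdd x) ?_
    filter_upwards [hnear y δ hδ, eventually_ge_atTop 1] with n hn hn1
    obtain ⟨m, rfl⟩ := Nat.exists_eq_add_of_le' hn1
    linarith [hu m x y]
  refine ⟨continuous_of_le_add_dist hcont hmod, ?_⟩
  have hloc : ∀ x : X, ∀ᶠ n in atTop, ∀ y,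
      dist (diracSlice hcont y) (diracSlice hcont x) < ε / 3 → u n y ≤ h y + ε := fun x => by
    filter_upwards [hnear x (ε / 3) (by linarith), eventually_ge_atTop 1] with n hn hn1 y hy
    obtain ⟨m, rfl⟩ := Nat.exists_eq_add_of_le' hn1
    have h1 := hu m y x
    have h2 := hmod x y
    rw [dist_comm] at h2
    linarith
  have hopen : ∀ x : X, {y | dist (diracSlice hcont y) (diracSlice hcont x) < ε / 3} ∈ 𝓝 x :=
    fun x => (isOpen_lt ((diracSlice hcont).continuous.dist continuous_const)
      continuous_const).mem_nhds (by simp [hε])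
  obtain ⟨t, -, ht⟩ := isCompact_univ.elim_nhds_subcover _ fun x _ => hopen x
  filter_upwards [(eventually_all_finset t).2 fun x _ => hloc x] with n hn y
  obtain ⟨x, hx, hy⟩ := mem_iUnion₂.1 (ht (mem_univ y))
  exact hn x hx y hy

/-- `T_∞ f` is a continuous fixed point of the Kantorovich operator, and its integral against any
`μ` with `T(μ, μ) = 0` is at least that of `f`. Indeed `h = limsup T^n f` is a subsolution,
`h ≤ T h`, so `T^n h` increases to `T_∞ f`. -/
lemma exists_kantorovichInfty [Nonempty X] (hT : IsBackwardLinearTransfer T)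
    (hcont : Continuous fun p : ProbabilityMeasure X × ProbabilityMeasure X => T p.1 p.2)
    (hrate : HasRate T 0) (f : C(X, ℝ)) :
    ∃ g : C(X, ℝ), kantorovichInfty T f = g ∧ kantorovichMap hcont g = g ∧
      ∀ μ : ProbabilityMeasure X, T μ μ = 0 →
        ∫ x, f x ∂(μ : Measure X) ≤ ∫ x, g x ∂(μ : Measure X) := by
  set K := kantorovichMap hcont with hK
  obtain ⟨C, hC⟩ := exists_abs_iterate_le hT hcont hrate f
  have hlim : ∀ x, kantorovichLimsup T f x = limsup (fun n => K^[n] f x) atTop := fun x => by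
    simp only [kantorovichLimsup, hK, coe_kantorovichMap_iterate]
  have hev := fun ε (hε : (0 : ℝ) < ε) => eventually_forall_le_limsup_add hcont hC
    (kantorovichMap_iterate_le_add_dist hcont f) hlim hε
  obtain ⟨h, hh⟩ : ∃ h : C(X, ℝ), (h : X → ℝ) = kantorovichLimsup T f :=
    ⟨⟨_, (hev 1 one_pos).1⟩, rfl⟩
  simp only [← hh] at hev hlim
  have hcobdd : ∀ x, IsCoboundedUnder (· ≤ ·) atTop fun n => K^[n] f x := fun x =>
    (isBoundedUnder_of ⟨-C, fun n => (abs_le.1 (hC n x)).1⟩ :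
      IsBoundedUnder (· ≥ ·) atTop fun n => K^[n] f x).isCoboundedUnder_le
  have hsub : ∀ x, h x ≤ K h x := fun x => by
    refine le_of_forall_pos_le_add fun ε hε => ?_
    rw [hlim x]
    refine limsup_le_of_le (hcobdd x) ?_
    filter_upwards [(tendsto_sub_atTop_nat 1).eventually (hev ε hε).2,
      eventually_ge_atTop 1] with n hn hn1
    obtain ⟨m, rfl⟩ := Nat.exists_eq_add_of_le' hn1
    rw [Function.iterate_succ_apply']
    exact kantorovich_le_add hcont _ _ ε hn x
  obtain ⟨C', hC'⟩ := exists_abs_iterate_le hT hcont hrate h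
  have hmono : ∀ x, Monotone fun n => K^[n] h x := fun x => monotone_nat_of_le_succ fun n => by
    rw [Function.iterate_succ_apply]
    simpa using kantorovichMap_iterate_le_add hcont h (K h) 0 (by simpa using hsub) n x
  have hbdd : ∀ x, BddAbove (range fun n => K^[n] h x) := fun x =>
    ⟨C', by rintro _ ⟨n, rfl⟩; exact (abs_le.1 (hC' n x)).2⟩
  have htend : ∀ x, Tendsto (fun n => K^[n] h x) atTop (𝓝 (⨆ n, K^[n] h x)) := fun x =>
    tendsto_atTop_ciSup (hmono x) (hbdd x)
  have hgmod : ∀ x y, (⨆ n, K^[n] h x) ≤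
      (⨆ n, K^[n] h y) + dist (diracSlice hcont x) (diracSlice hcont y) := fun x y =>
    le_of_tendsto_of_tendsto' ((tendsto_add_atTop_iff_nat 1).2 (htend x))
      (((tendsto_add_atTop_iff_nat 1).2 (htend y)).add_const _)
      fun n => kantorovichMap_iterate_le_add_dist hcont h n x y
  obtain ⟨g, hg⟩ : ∃ g : C(X, ℝ), ∀ x, g x = ⨆ n, K^[n] h x :=
    ⟨⟨_, continuous_of_le_add_dist hcont hgmod⟩, fun _ => rfl⟩
  simp only [← hg] at htend
  have hle : ∀ n x, K^[n] h x ≤ g x := fun n x => by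
    rw [hg]
    exact le_ciSup (hbdd x) n
  refine ⟨g, ?_, ?_, fun μ hμ => ?_⟩
  · funext x
    refine Tendsto.limUnder_eq ?_
    simpa only [← hh, ← coe_kantorovichMap_iterate hcont] using htend x
  · ext x
    have : Nonempty (ProbabilityMeasure X) := ⟨diracProba (Classical.arbitrary X)⟩
    refine le_antisymm (ciSup_le fun ν => ?_) ?_
    -- `T g ≤ g`: pass to the limit in `∫ T^n h dν - T(δ_x, ν) ≤ T^{n+1} h (x)` for each `ν`.
    · have hint : Tendsto (fun n => ∫ y, K^[n] h y ∂(ν : Measure X)) atTop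
          (𝓝 (∫ y, g y ∂(ν : Measure X))) :=
        tendsto_integral_of_dominated_convergence (fun _ => C')
          (fun n => (integrable_continuousMap ν _).aestronglyMeasurable) (integrable_const C')
          (fun n => Eventually.of_forall (hC' n)) (Eventually.of_forall htend)
      refine le_of_tendsto_of_tendsto' (hint.sub_const _)
        ((tendsto_add_atTop_iff_nat 1).2 (htend x)) fun n => ?_
      rw [Function.iterate_succ_apply']
      exact le_legendre hcont (diracProba x) ν (K^[n] h)
    · refine le_of_tendsto' ((tendsto_add_atTop_iff_nat 1).2 (htend x)) fun n => ?_
      rw [Function.iterate_succ_apply']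
      have h1 := kantorovich_le_add hcont (K^[n] h) g 0 (by simpa using hle n) x
      rw [add_zero] at h1
      exact h1
  · refine le_of_forall_pos_le_add fun ε hε => ?_
    obtain ⟨n, hn⟩ := (hev ε hε).2.exists
    exact (integral_le_integral_iterate hT hcont hμ f n).trans
      (integral_le_integral_add μ _ g ε fun x => (hn x).trans (add_le_add_left (hle 0 x) ε))

/-! ### The barrier on the diagonal -/

lemma kantorovichInfty_of_fixed [Nonempty X]
    (hcont : Continuous fun p : ProbabilityMeasure X × ProbabilityMeasure X => T p.1 p.2)
    {g : C(X, ℝ)} (hg : kantorovichMap hcont g = g) : kantorovichInfty T g = g := by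
  have hfix : ∀ n, (kantorovich T)^[n] g = g :=
    Function.iterate_fixed (congrArg DFunLike.coe hg : kantorovich T g = g)
  have hlim : kantorovichLimsup T g = g := by
    funext x
    simp only [kantorovichLimsup, hfix, limsup_const]
  funext x
  simp only [kantorovichInfty, hlim, hfix]
  exact tendsto_const_nhds.limUnder_eq

lemma barrier_self_eq_zero [Nonempty X] (hT : IsBackwardLinearTransfer T)
    (hcont : Continuous fun p : ProbabilityMeasure X × ProbabilityMeasure X => T p.1 p.2)
    (hrate : HasRate T 0) {μ : ProbabilityMeasure X} (hμ : T μ μ = 0) : barrier T μ μ = 0 := by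
  refine le_antisymm (iSup_le fun f => ?_) ?_
  · obtain ⟨g, hg, -, hfg⟩ := exists_kantorovichInfty hT hcont hrate f
    rw [hg]
    exact_mod_cast sub_nonpos.2 (hfg μ hμ)
  · obtain ⟨g, -, hg, -⟩ := exists_kantorovichInfty hT hcont hrate 0
    refine le_iSup_of_le g ?_
    rw [kantorovichInfty_of_fixed hcont hg, sub_self, EReal.coe_zero]

end Transfer

theorem theorem3 {X : Type*} [MetricSpace X] [CompactSpace X] [Nonempty X]
    [MeasurableSpace X] [BorelSpace X]
    (T : ProbabilityMeasure X → ProbabilityMeasure X → ℝ)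
    (hT : Transfer.IsBackwardLinearTransfer T)
    (hcont : Continuous fun p : ProbabilityMeasure X × ProbabilityMeasure X => T p.1 p.2)
    (hrate : Transfer.HasRate T 0) :
    IsGLB (Set.range fun μ : ProbabilityMeasure X => T μ μ) 0 ∧
      ∃ μ' : ProbabilityMeasure X,
        μ' ∈ Transfer.projectedAubrySet T ∧ T μ' μ' = 0 ∧ (μ', μ') ∈ Transfer.aubrySet T := by
  obtain ⟨B, hB⟩ := Transfer.exists_abs_le hcont
  obtain ⟨μ, hμ⟩ := Transfer.exists_self_eq_zero hT.convex hcont hrate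
  have hbar := Transfer.barrier_self_eq_zero hT hcont hrate hμ
  refine ⟨⟨?_, fun b hb => hμ ▸ hb ⟨μ, rfl⟩⟩, μ, hbar, hμ, ?_⟩
  · rintro _ ⟨ν, rfl⟩
    exact Transfer.self_nonneg hB hrate ν
  · simp [Transfer.aubrySet, hμ, hbar]
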